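/- Let $\mathcal X$ be a separable real Hilbert space and let $\mu=N(0,\mathcal K)$ be a centered Gaussian measure on $\mathcal X$ with covariance operator $\mathcal K$, i.e. a Borel probability measure with mean $0$ whose image under every bounded linear functional is a (possibly degenerate) Gaussian measure on $\mathbb R$. Let $\mathcal K^{1/2}$ be the positive square root of $\mathcal K$, and let $\mathcal H(\mu):=\mathcal K^{1/2}\mathcal X$ be the Cameron--Martin space of $\mu$, with norm $\|u\|_{\mathcal H(\mu)}:=\|\mathcal K^{-1/2}u\|_{\mathcal X}$; here $\mathcal K^{-1/2}u$ is the unique $x\in\mathcal X$ orthogonal to $\ker\mathcal K^{1/2}$ with $\mathcal K^{1/2}x=u$ (the only solution $x$ if $\mathcal K$ is injective). Let $\phi=(\phi_1,\dots,\phi_N)$ with $\phi_i\in\mathcal X^\ast$, write $\phi(u):=(\phi_1(u),\dots,\phi_N(u))\in\mathbb R^N$, and let $F:\mathbb R^N\to\mathbb R^M$ be locally Lipschitz: for every $r>0$ there is $L(r)>0$ such that $|F(z_1)-F(z_2)|\le L(r)\,|z_1-z_2|$ for all $z_1,z_2$ in the ball of radius $r$ about $0$, where $|\cdot|$ is the Euclidean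 norm. For $y\in\mathbb R^M$ and $\beta>0$ let $\mu^y_\beta$ be the probability measure on $\mathcal X$ given by $$\frac{\mathrm d\mu^y_\beta}{\mathrm d\mu}(u)=\frac1{\omega_\beta(y)}\exp\Big(-\frac1{2\beta^2}|F(\phi(u))-y|^2\Big),\qquad \omega_\beta(y):=\int_{\mathcal X}\exp\Big(-\frac1{2\beta^2}|F(\phi(v))-y|^2\Big)\,\mu(\mathrm dv),$$ and let $J^y_\beta:\mathcal X\to[0,\infty]$ be the Onsager--Machlup functional $$J^y_\beta(u):=\begin{cases}\dfrac1{2\beta^2}|F(\phi(u))-y|^2+\dfrac12\|u\|^2_{\mathcal H(\mu)},&u\in\mathcal H(\mu),\\[1ex]+\infty,&u\in\mathcal X\setminus\mathcal H(\mu).\end{cases}$$ Then a point $u^\dagger\in\mathcal X$ is a MAP estimator (mode) of $\mu^y_\beta$, meaning that $$\lim_{r\downarrow0}\frac{\mu^y_\beta(B_r(u^\dagger))}{\sup_{u\in\mathcal X}\mu^y_\beta(B_r(u))}=1,$$ where $B_r(u)$ is the open ball in $\mathcal X$ of radius $r$ about $u$, if and only if $u^\dagger$ is a (global) minimizer of $J^y_\beta$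 over $\mathcal X$. -/

import Mathlib

open MeasureTheory ProbabilityTheory Filter Topology
open scoped ENNReal InnerProductSpace

namespace GaussianMAP

section PositiveSqrt

variable {X : Type*} [NormedAddCommGroup X] [InnerProductSpace ℝ X] [CompleteSpace X]

/-- If `‖A‖ ≤ 1`, the equation `B = (A + B ^ 2) / 2` has a solution in the closed unit ball,
obtained as the limit of the iteration started at `0`; it commutes with everything that commutes
with `A`, and it is self-adjoint when `A` is. -/
lemma exists_half_add_sq (A : X →L[ℝ] X) (hA : ‖A‖ ≤ 1) (hsa : IsSelfAdjoint A) :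
    ∃ B : X →L[ℝ] X, ‖B‖ ≤ 1 ∧ IsSelfAdjoint B ∧ B + B = A + B * B ∧
      ∀ T : X →L[ℝ] X, Commute T A → Commute T B := by
  obtain ⟨B, hB0, hB⟩ : ∃ B : ℕ → X →L[ℝ] X, B 0 = 0 ∧
      ∀ n, B (n + 1) = (1 / 2 : ℝ) • (A + B n * B n) :=
    ⟨fun n => Nat.rec 0 (fun _ C => (1 / 2 : ℝ) • (A + C * C)) n, rfl, fun _ => rfl⟩
  obtain ⟨b, hb0, hb⟩ : ∃ b : ℕ → ℝ, b 0 = 0 ∧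
      ∀ n, b (n + 1) = (1 / 2 : ℝ) * (1 + b n * b n) :=
    ⟨fun n => Nat.rec 0 (fun _ c => (1 / 2 : ℝ) * (1 + c * c)) n, rfl, fun _ => rfl⟩
  have hbnn : ∀ n, 0 ≤ b n ∧ b n ≤ 1 := by
    intro n
    induction n with
    | zero => simp [hb0]
    | succ n ih =>
      rw [hb]
      constructor <;> nlinarith [ih.1, ih.2]
  have hBb : ∀ n, ‖B n‖ ≤ b n := by
    intro n
    induction n with
    | zero => simp [hB0, hb0]
    | succ n ih =>
      rw [hB, hb, norm_smul, Real.norm_of_nonneg (by norm_num)]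
      have h1 : ‖A + B n * B n‖ ≤ ‖A‖ + ‖B n‖ * ‖B n‖ :=
        (norm_add_le _ _).trans (by gcongr; exact norm_mul_le _ _)
      have h2 : ‖B n‖ * ‖B n‖ ≤ b n * b n :=
        mul_le_mul ih ih (norm_nonneg _) (hbnn n).1
      linarith
  have hdiff : ∀ n, ‖B (n + 1) - B n‖ ≤ b (n + 1) - b n := by
    intro n
    induction n with
    | zero =>
      have := hBb 1
      simpa [hB0, hb0] using this
    | succ n ih =>
      have e : B (n + 1 + 1) - B (n + 1)
          = (1 / 2 : ℝ) • (B (n + 1) * (B (n + 1) - B n) + (B (n + 1) - B n) * B n) := by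
        have e0 : B (n + 1 + 1) - B (n + 1)
            = (1 / 2 : ℝ) • (A + B (n + 1) * B (n + 1)) - (1 / 2 : ℝ) • (A + B n * B n) := by
          rw [← hB, ← hB]
        rw [e0, ← smul_sub]
        congr 1
        generalize B (n + 1) = C
        noncomm_ring
      have e' : b (n + 1 + 1) - b (n + 1)
          = (1 / 2 : ℝ) * (b (n + 1) * (b (n + 1) - b n) + (b (n + 1) - b n) * b n) := by
        have e0 : b (n + 1 + 1) - b (n + 1)
            = (1 / 2 : ℝ) * (1 + b (n + 1) * b (n + 1)) - (1 / 2 : ℝ) * (1 + b n * b n) := by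
          rw [← hb, ← hb]
        rw [e0]
        ring
      rw [e, e', norm_smul, Real.norm_of_nonneg (by norm_num)]
      have hd : 0 ≤ b (n + 1) - b n := (norm_nonneg _).trans ih
      have h1 := norm_add_le (B (n + 1) * (B (n + 1) - B n)) ((B (n + 1) - B n) * B n)
      have h2 := norm_mul_le (B (n + 1)) (B (n + 1) - B n)
      have h3 := norm_mul_le (B (n + 1) - B n) (B n)
      have h4 := mul_le_mul (hBb (n + 1)) ih (norm_nonneg _) (hbnn (n + 1)).1
      have h5 := mul_le_mul ih (hBb n) (norm_nonneg _) hd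
      linarith
  have hsum : Summable fun n => b (n + 1) - b n := by
    refine summable_of_sum_range_le (c := 1) (fun n => (norm_nonneg _).trans (hdiff n)) ?_
    intro n
    rw [Finset.sum_range_sub, hb0, sub_zero]
    exact (hbnn n).2
  have hcau : CauchySeq B := by
    refine cauchySeq_of_dist_le_of_summable _ (fun n => ?_) hsum
    rw [dist_eq_norm, norm_sub_rev]
    exact hdiff n
  obtain ⟨L, hL⟩ := cauchySeq_tendsto_of_complete hcau
  have hlim : Tendsto (fun n => B (n + 1)) atTop (𝓝 ((1 / 2 : ℝ) • (A + L * L))) := by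
    simp only [hB]
    exact (tendsto_const_nhds.add (hL.mul hL)).const_smul _
  have hfix : L = (1 / 2 : ℝ) • (A + L * L) :=
    tendsto_nhds_unique ((tendsto_add_atTop_iff_nat 1).2 hL) hlim
  refine ⟨L, ?_, ?_, ?_, ?_⟩
  · exact le_of_tendsto hL.norm (Eventually.of_forall fun n => (hBb n).trans (hbnn n).2)
  · have hn : ∀ n, IsSelfAdjoint (B n) := by
      intro n
      induction n with
      | zero => rw [hB0]; exact IsSelfAdjoint.zero _
      | succ n ih =>
        rw [hB]
        refine IsSelfAdjoint.smul (IsSelfAdjoint.all _) (hsa.add ?_)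
        rw [← pow_two]
        exact ih.pow 2
    have h1 : Tendsto (fun n => star (B n)) atTop (𝓝 (star L)) := hL.star
    simp only [fun n => (hn n).star_eq] at h1
    exact tendsto_nhds_unique h1 hL
  · have : L + L = (2 : ℝ) • L := (two_smul ℝ L).symm
    rw [this]
    nth_rewrite 1 [hfix]
    rw [smul_smul]
    norm_num
  · intro T hT
    have hn : ∀ n, Commute T (B n) := by
      intro n
      induction n with
      | zero => rw [hB0]; exact Commute.zero_right _
      | succ n ih =>
        rw [hB]
        exact (hT.add_right (ih.mul_right ih)).smul_right _
    have h1 : Tendsto (fun n => T * B n) atTop (𝓝 (T * L)) := tendsto_const_nhds.mul hL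
    have h2 : Tendsto (fun n => B n * T) atTop (𝓝 (L * T)) := hL.mul tendsto_const_nhds
    simp only [fun n => (hn n).eq] at h1
    exact tendsto_nhds_unique h1 h2

/-- A positive bounded operator on a real Hilbert space has a unique positive square root. -/
theorem existsUnique_posSqrt (K : X →L[ℝ] X) (hK : K.IsPositive) :
    ∃! S : X →L[ℝ] X, S.IsPositive ∧ S * S = K := by
  have hex : ∃ S : X →L[ℝ] X, S.IsPositive ∧ S * S = K ∧
      ∀ T : X →L[ℝ] X, Commute T K → Commute T S := by
    rcases eq_or_ne K 0 with rfl | hK0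
    · exact ⟨0, ContinuousLinearMap.isPositive_zero, by simp, fun T _ => Commute.zero_right T⟩
    have hc : 0 < ‖K‖ := norm_pos_iff.2 hK0
    have hAsa : IsSelfAdjoint (1 - ‖K‖⁻¹ • K) :=
      (IsSelfAdjoint.one _).sub (IsSelfAdjoint.smul (IsSelfAdjoint.all _) hK.isSelfAdjoint)
    have hA : ‖1 - ‖K‖⁻¹ • K‖ ≤ 1 := by
      rw [ContinuousLinearMap.norm_eq_iSup_rayleighQuotient _
        (ContinuousLinearMap.isSelfAdjoint_iff_isSymmetric.1 hAsa)]
      refine ciSup_le fun x => ?_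
      rw [ContinuousLinearMap.rayleighQuotient, abs_div, abs_of_nonneg (sq_nonneg ‖x‖)]
      refine div_le_one_of_le₀ ?_ (sq_nonneg _)
      have h1 : (1 - ‖K‖⁻¹ • K).reApplyInnerSelf x = ‖x‖ ^ 2 - ‖K‖⁻¹ * ⟪K x, x⟫_ℝ := by
        simp [ContinuousLinearMap.reApplyInnerSelf_apply, inner_sub_left, inner_smul_left]
      have h2 : 0 ≤ ⟪K x, x⟫_ℝ := hK.inner_nonneg_left x
      have h3 : ⟪K x, x⟫_ℝ ≤ ‖K‖ * ‖x‖ ^ 2 := by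
        have := (real_inner_le_norm (K x) x).trans
          (mul_le_mul_of_nonneg_right (K.le_opNorm x) (norm_nonneg x))
        nlinarith
      have h4 : ‖K‖⁻¹ * ⟪K x, x⟫_ℝ ≤ ‖x‖ ^ 2 := by
        rwa [inv_mul_le_iff₀ hc]
      have h5 : 0 ≤ ‖K‖⁻¹ * ⟪K x, x⟫_ℝ := by positivity
      rw [h1, abs_le]
      constructor <;> nlinarith [sq_nonneg ‖x‖]
    obtain ⟨B, hB1, hBsa, hBeq, hBcomm⟩ := exists_half_add_sq _ hA hAsa
    refine ⟨√‖K‖ • (1 - B), ?_, ?_, ?_⟩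
    · refine ContinuousLinearMap.IsPositive.smul_of_nonneg ?_ (Real.sqrt_nonneg _)
      rw [ContinuousLinearMap.isPositive_iff']
      refine ⟨(IsSelfAdjoint.one _).sub hBsa, fun x => ?_⟩
      have h1 : ⟪B x, x⟫_ℝ ≤ ‖x‖ * ‖x‖ :=
        (real_inner_le_norm (B x) x).trans
          (mul_le_mul_of_nonneg_right
            ((B.le_opNorm x).trans (mul_le_of_le_one_left (norm_nonneg x) hB1)) (norm_nonneg x))
      have h2 : ⟪(1 - B) x, x⟫_ℝ = ‖x‖ * ‖x‖ - ⟪B x, x⟫_ℝ := by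
        simp [inner_sub_left, pow_two]
      rw [h2]
      linarith
    · have h1 : (1 - B) * (1 - B) = ‖K‖⁻¹ • K := by
        have : (1 - B) * (1 - B) = 1 - (B + B) + B * B := by noncomm_ring
        rw [this, hBeq]
        abel
      rw [smul_mul_smul_comm, h1, Real.mul_self_sqrt hc.le, smul_smul, mul_inv_cancel₀ hc.ne',
        one_smul]
    · intro T hT
      refine Commute.smul_right ?_ _
      refine (Commute.one_right T).sub_right (hBcomm T ?_)
      exact (Commute.one_right T).sub_right (hT.smul_right _)
  obtain ⟨S, hS, hSS, hScomm⟩ := hex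
  refine ⟨S, ⟨hS, hSS⟩, ?_⟩
  rintro T ⟨hT, hTT⟩
  have hTS : T * S = S * T := hScomm T (by rw [← hTT]; exact (Commute.refl T).mul_right rfl)
  have hDsa : IsSelfAdjoint (T - S) := hT.isSelfAdjoint.sub hS.isSelfAdjoint
  have hDsymm : ∀ x y, ⟪(T - S) x, y⟫_ℝ = ⟪x, (T - S) y⟫_ℝ :=
    ContinuousLinearMap.isSelfAdjoint_iff_isSymmetric.1 hDsa
  have hD0 : ∀ x, ⟪(T - S) ((T - S) x), (T - S) x⟫_ℝ = 0 := by
    intro x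
    have h1 : (T + S) * (T - S) = 0 := by
      have : (T + S) * (T - S) = T * T - S * S + (S * T - T * S) := by noncomm_ring
      rw [this, hTT, hSS, hTS]
      simp
    have h2 : T ((T - S) x) + S ((T - S) x) = 0 := by
      simpa using! congrArg (fun L : X →L[ℝ] X => L x) h1
    have h3 : ⟪T ((T - S) x), (T - S) x⟫_ℝ + ⟪S ((T - S) x), (T - S) x⟫_ℝ = 0 := by
      rw [← inner_add_left, h2, inner_zero_left]
    have h4 := hT.inner_nonneg_left ((T - S) x)
    have h5 := hS.inner_nonneg_left ((T - S) x)
    have h6 : ⟪(T - S) ((T - S) x), (T - S) x⟫_ℝ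
        = ⟪T ((T - S) x), (T - S) x⟫_ℝ - ⟪S ((T - S) x), (T - S) x⟫_ℝ := by
      rw [← inner_sub_left]; rfl
    rw [h6]
    linarith
  have hcube : (((T - S) * (T - S) * (T - S) : X →L[ℝ] X) : X →ₗ[ℝ] X) = 0 := by
    refine (LinearMap.IsSymmetric.inner_map_self_eq_zero ?_).1 fun x => ?_
    · intro x y
      change ⟪(T - S) ((T - S) ((T - S) x)), y⟫_ℝ = ⟪x, (T - S) ((T - S) ((T - S) y))⟫_ℝ
      rw [hDsymm, hDsymm, hDsymm]
    · change ⟪(T - S) ((T - S) ((T - S) x)), x⟫_ℝ = 0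
      rw [hDsymm]
      exact hD0 x
  have hcube' : ∀ x, (T - S) ((T - S) ((T - S) x)) = 0 := fun x => LinearMap.congr_fun hcube x
  have hsq : ∀ x, (T - S) ((T - S) x) = 0 := by
    intro x
    rw [← inner_self_eq_zero (𝕜 := ℝ), hDsymm, hcube', inner_zero_right]
  have hone : ∀ x, (T - S) x = 0 := by
    intro x
    rw [← inner_self_eq_zero (𝕜 := ℝ), hDsymm, hsq, inner_zero_right]
  exact sub_eq_zero.1 (ContinuousLinearMap.ext hone)

/-- The positive square root `K ^ (1 / 2)` of a positive bounded operator `K`. -/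
noncomputable def posSqrt (K : X →L[ℝ] X) (hK : K.IsPositive) : X →L[ℝ] X :=
  (existsUnique_posSqrt K hK).choose

lemma posSqrt_isPositive (K : X →L[ℝ] X) (hK : K.IsPositive) : (posSqrt K hK).IsPositive :=
  (existsUnique_posSqrt K hK).choose_spec.1.1

lemma posSqrt_mul_self (K : X →L[ℝ] X) (hK : K.IsPositive) :
    posSqrt K hK * posSqrt K hK = K :=
  (existsUnique_posSqrt K hK).choose_spec.1.2

end PositiveSqrt

section CameronMartin

variable {X : Type*} [NormedAddCommGroup X] [InnerProductSpace ℝ X] [CompleteSpace X]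
  [MeasurableSpace X] [BorelSpace X]

/-- The square root `K ^ (1 / 2)` of the covariance operator `K` of `μ`. (Mathlib's
`covarianceOperator` is uncentered, which for a centered measure is the covariance operator.) -/
noncomputable def covSqrt (μ : Measure X) : X →L[ℝ] X :=
  posSqrt (covarianceOperator μ)
    ((ContinuousLinearMap.isPositive_toLinearMap_iff _).1 isPositive_covarianceOperator)

/-- The Cameron-Martin space `H(μ) = K ^ (1 / 2) X` of a centered Gaussian measure `μ = N(0, K)`. -/
noncomputable def cameronMartin (μ : Measure X) : Submodule ℝ X :=
  LinearMap.range (covSqrt μ : X →ₗ[ℝ] X)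

/-- `K ^ (-1 / 2) u` for `u ∈ K ^ (1 / 2) X`: the solution `x` of `K ^ (1 / 2) x = u` which is
orthogonal to the kernel of `K ^ (1 / 2)`, i.e. the only solution if `K` is injective, and the
solution of least norm (pseudo-inverse) in general. It is obtained by projecting any solution, see
`covSqrt_covInvSqrt`, `covInvSqrt_mem` and `covInvSqrt_unique`. -/
noncomputable def covInvSqrt (μ : Measure X) (u : cameronMartin μ) : X :=
  (LinearMap.ker (covSqrt μ : X →ₗ[ℝ] X))ᗮ.starProjection (LinearMap.mem_range.1 u.2).choose

lemma covInvSqrt_mem (μ : Measure X) (u : cameronMartin μ) :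
    covInvSqrt μ u ∈ (LinearMap.ker (covSqrt μ : X →ₗ[ℝ] X))ᗮ :=
  Submodule.starProjection_apply_mem _ _

lemma covSqrt_covInvSqrt (μ : Measure X) (u : cameronMartin μ) :
    covSqrt μ (covInvSqrt μ u) = u := by
  have : CompleteSpace (LinearMap.ker (covSqrt μ : X →ₗ[ℝ] X)) :=
    (covSqrt μ).isClosed_ker.completeSpace_coe
  have h := (LinearMap.mem_range.1 u.2).choose_spec
  set x := (LinearMap.mem_range.1 u.2).choose
  have h1 : x - covInvSqrt μ u ∈ LinearMap.ker (covSqrt μ : X →ₗ[ℝ] X) := by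
    have := Submodule.sub_starProjection_mem_orthogonal
      (K := (LinearMap.ker (covSqrt μ : X →ₗ[ℝ] X))ᗮ) x
    rwa [Submodule.orthogonal_orthogonal] at this
  have h2 : covSqrt μ (x - covInvSqrt μ u) = 0 := h1
  rw [map_sub, sub_eq_zero] at h2
  rw [← h2]
  exact h

lemma covInvSqrt_unique (μ : Measure X) (u : cameronMartin μ) (x : X)
    (hx : x ∈ (LinearMap.ker (covSqrt μ : X →ₗ[ℝ] X))ᗮ) (hxu : covSqrt μ x = u) :
    x = covInvSqrt μ u := by
  have h1 : x - covInvSqrt μ u ∈ LinearMap.ker (covSqrt μ : X →ₗ[ℝ] X) := by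
    change covSqrt μ (x - covInvSqrt μ u) = 0
    rw [map_sub, hxu, covSqrt_covInvSqrt, sub_self]
  have h2 := Submodule.sub_mem _ hx (covInvSqrt_mem μ u)
  exact sub_eq_zero.1 (inner_self_eq_zero (𝕜 := ℝ).1 (h2 _ h1))

/-- The Cameron-Martin norm `‖u‖_{H(μ)} = ‖K ^ (-1 / 2) u‖`. -/
noncomputable def cameronMartinNorm (μ : Measure X) (u : cameronMartin μ) : ℝ :=
  ‖covInvSqrt μ u‖

end CameronMartin

section Posterior

variable {X : Type*} [NormedAddCommGroup X] [InnerProductSpace ℝ X] {N M : ℕ}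

/-- The observation map `G = F ∘ φ`, with `φ = (φ₁, …, φ_N)` a vector of bounded functionals. -/
noncomputable def obsMap (φ : Fin N → StrongDual ℝ X)
    (F : EuclideanSpace ℝ (Fin N) → EuclideanSpace ℝ (Fin M)) (u : X) : EuclideanSpace ℝ (Fin M) :=
  F (WithLp.toLp 2 fun i => φ i u)

/-- The posterior measure: its density with respect to `μ` is `exp (- |F (φ u) - y|² / (2 β²))`
divided by the normalizing constant `∫ exp (- |F (φ v) - y|² / (2 β²)) dμ(v)`. -/
noncomputable def posterior [MeasurableSpace X] (μ : Measure X) (φ : Fin N → StrongDual ℝ X)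
    (F : EuclideanSpace ℝ (Fin N) → EuclideanSpace ℝ (Fin M)) (y : EuclideanSpace ℝ (Fin M))
    (β : ℝ) : Measure X :=
  μ.withDensity fun u => ENNReal.ofReal
    (Real.exp (-(1 / (2 * β ^ 2)) * ‖obsMap φ F u - y‖ ^ 2) /
      ∫ v, Real.exp (-(1 / (2 * β ^ 2)) * ‖obsMap φ F v - y‖ ^ 2) ∂μ)

/-- `F` is Lipschitz on every ball centered at the origin. -/
def IsLocallyLipschitz (F : EuclideanSpace ℝ (Fin N) → EuclideanSpace ℝ (Fin M)) : Prop :=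
  ∀ r : ℝ, 0 < r → ∃ L : ℝ, 0 < L ∧
    ∀ z₁ ∈ Metric.ball (0 : EuclideanSpace ℝ (Fin N)) r,
      ∀ z₂ ∈ Metric.ball (0 : EuclideanSpace ℝ (Fin N)) r, ‖F z₁ - F z₂‖ ≤ L * ‖z₁ - z₂‖

/-- `u` is a mode of `ν`: `ν (B_r(u)) / sup_v ν (B_r(v)) → 1` as the radius `r > 0` tends to `0`. -/
def IsMode [MeasurableSpace X] (ν : Measure X) (u : X) : Prop :=
  Tendsto (fun r : ℝ => ν (Metric.ball u r) / ⨆ v : X, ν (Metric.ball v r)) (𝓝[>] 0) (𝓝 1)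

open Classical in
/-- The Onsager-Machlup functional
`J(u) = |F (φ u) - y|² / (2 β²) + ‖u‖²_{H(μ)} / 2` on `H(μ)`, and `J(u) = ∞` outside `H(μ)`. -/
noncomputable def onsagerMachlup [CompleteSpace X] [MeasurableSpace X] [BorelSpace X]
    (μ : Measure X) (φ : Fin N → StrongDual ℝ X)
    (F : EuclideanSpace ℝ (Fin N) → EuclideanSpace ℝ (Fin M)) (y : EuclideanSpace ℝ (Fin M))
    (β : ℝ) (u : X) : ℝ≥0∞ :=
  if hu : u ∈ cameronMartin μ then
    ENNReal.ofReal (1 / (2 * β ^ 2) * ‖obsMap φ F u - y‖ ^ 2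
      + 1 / 2 * cameronMartinNorm μ ⟨u, hu⟩ ^ 2)
  else ⊤

end Posterior

end GaussianMAP

/-!
Let `K` be the covariance operator of `μ`. In an orthonormal basis of a finite-dimensional subspace
that diagonalises the quadratic form of `K`, the coordinates of `μ` are independent centered
Gaussians, and moving one coordinate of the center of a ball to `0` increases the mass of the ball.
Projecting onto larger and larger subspaces yields Anderson's inequality `μ (B_r v) ≤ μ (B_r 0)`.

Together with the Cameron-Martin formula it gives, for `v = (K + r) w` and `x = K ^ (1 / 2) w`,
`μ (B_r v) ≤ exp (-(‖x‖² + ‖v - K ^ (1 / 2) x‖² / r) / 2 + r / 2) * μ (B_r 0)`,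
while symmetry of `μ` gives `exp (-‖u‖²_{H(μ)} / 2) * μ (B_r 0) ≤ μ (B_r u)` for `u ∈ H(μ)`.

Let `Φ` be the potential of the posterior, `ν = exp (-Φ) μ`, and call `Φ u + ‖u‖²_{H(μ)} / 2` the
energy of `u ∈ H(μ)`. The upper bound is uniform in `v`, and `K ^ (1 / 2)` turns weak convergence
into strong convergence: if `r_n → 0` and `ν (B_{r_n} v_n) ≥ exp (-a) * μ (B_{r_n} 0)`, then `v_n`
accumulates at a point of `H(μ)` of energy at most `a`. By the lower bound,
`ν (B_r u) ≥ exp (-a) * μ (B_r 0)` for small `r` whenever `u` has energy less than `a`. Hence the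
supremum over `u` of `ν (B_r u)` is asymptotic to `exp (-m) * μ (B_r 0)` with `m` the infimum of the
energy, and it is attained asymptotically exactly at the points of energy `m`.
-/

namespace GaussianMAP

section Anderson

lemma gaussianPDF_zero_le_of_sq_le (v : NNReal) {x y : ℝ} (h : y ^ 2 ≤ x ^ 2) :
    gaussianPDF 0 v x ≤ gaussianPDF 0 v y := by
  simp only [gaussianPDF, gaussianPDFReal_def, sub_zero]
  gcongr

lemma gaussianReal_setOf_sq_sub_lt_le (v : NNReal) (a s : ℝ) :
    gaussianReal 0 v {x | (x - a) ^ 2 < s} ≤ gaussianReal 0 v {x | x ^ 2 < s} := by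
  rcases eq_or_ne v 0 with rfl | hv
  · rcases le_or_gt s 0 with hs | hs
    · simp [(hs.trans (sq_nonneg _)).not_gt]
    · have h0 : gaussianReal 0 0 {x | x ^ 2 < s} = 1 := by
        rw [gaussianReal_zero_var, Measure.dirac_apply_of_mem (by simpa using hs)]
      exact h0 ▸ prob_le_one
  have hI : MeasurableSet {x : ℝ | x ^ 2 < s} := measurableSet_lt (by fun_prop) (by fun_prop)
  have hA : MeasurableSet {x : ℝ | (x - a) ^ 2 < s} := measurableSet_lt (by fun_prop) (by fun_prop)
  -- The reflection about `a / 2` exchanges the two differences and increases the density on the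
  -- one off the centered interval.
  have hrefl : (fun x => a - x) ⁻¹' ({x | x ^ 2 < s} \ {x | (x - a) ^ 2 < s})
      = {x | (x - a) ^ 2 < s} \ {x | x ^ 2 < s} := by
    ext x
    simp [sub_sq_comm a x]
  have hdiff : gaussianReal 0 v ({x | (x - a) ^ 2 < s} \ {x | x ^ 2 < s})
      ≤ gaussianReal 0 v ({x | x ^ 2 < s} \ {x | (x - a) ^ 2 < s}) := by
    rw [gaussianReal_apply _ hv, gaussianReal_apply _ hv,
      ← (volume.measurePreserving_sub_left a).setLIntegral_comp_preimage (hI.diff hA)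
        (measurable_gaussianPDF 0 v), hrefl]
    refine setLIntegral_mono' (hA.diff hI) fun x hx => gaussianPDF_zero_le_of_sq_le v ?_
    rw [sub_sq_comm]
    exact hx.1.le.trans (not_lt.1 hx.2)
  rw [← measure_inter_add_sdiff _ hI, ← measure_inter_add_sdiff {x : ℝ | x ^ 2 < s} hA,
    Set.inter_comm]
  gcongr

variable {Ω : Type*} [MeasurableSpace Ω] {P : Measure Ω} [IsProbabilityMeasure P]

lemma measure_sq_sub_add_lt_le {ξ Y : Ω → ℝ} (hξ : Measurable ξ) (hY : Measurable Y)
    (hind : IndepFun ξ Y P) {v : NNReal} (hlaw : P.map ξ = gaussianReal 0 v) (a s : ℝ) :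
    P {ω | (ξ ω - a) ^ 2 + Y ω < s} ≤ P {ω | ξ ω ^ 2 + Y ω < s} := by
  have fubini (c : ℝ) : P {ω | (ξ ω - c) ^ 2 + Y ω < s}
      = ∫⁻ y, gaussianReal 0 v {x | (x - c) ^ 2 < s - y} ∂(P.map Y) := by
    have hm : MeasurableSet {p : ℝ × ℝ | (p.2 - c) ^ 2 + p.1 < s} :=
      measurableSet_lt (by fun_prop) (by fun_prop)
    have : IsProbabilityMeasure (P.map Y) := Measure.isProbabilityMeasure_map hY.aemeasurable
    calc P {ω | (ξ ω - c) ^ 2 + Y ω < s}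
        = P.map (fun ω => (Y ω, ξ ω)) {p : ℝ × ℝ | (p.2 - c) ^ 2 + p.1 < s} :=
          (Measure.map_apply (hY.prodMk hξ) hm).symm
      _ = _ := by
          rw [(indepFun_iff_map_prod_eq_prod_map_map hY.aemeasurable hξ.aemeasurable).1 hind.symm,
            hlaw, Measure.prod_apply hm]
          simp only [Set.preimage_ofPred_eq, lt_sub_iff_add_lt]
  have fubini_zero := fubini 0
  simp only [sub_zero] at fubini_zero
  rw [fubini a, fubini_zero]
  exact lintegral_mono fun y => gaussianReal_setOf_sq_sub_lt_le v a (s - y)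

lemma measure_sum_sq_sub_lt_le_update {ι : Type*} [Fintype ι] [DecidableEq ι] {ξ : ι → Ω → ℝ}
    (hξ : ∀ i, Measurable (ξ i)) (hind : iIndepFun ξ P) {v : ι → NNReal}
    (hlaw : ∀ i, P.map (ξ i) = gaussianReal 0 (v i)) (a : ι → ℝ) (s : ℝ) (j : ι) :
    P {ω | ∑ i, (ξ i ω - a i) ^ 2 < s}
      ≤ P {ω | ∑ i, (ξ i ω - Function.update a j 0 i) ^ 2 < s} := by
  let Y (ω : Ω) : ℝ := ∑ i ∈ Finset.univ.erase j, (ξ i ω - a i) ^ 2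
  have hindY : IndepFun (ξ j) Y P := by
    have hφ : Measurable fun f : ({j} : Finset ι) → ℝ => f ⟨j, Finset.mem_singleton_self j⟩ :=
      measurable_pi_apply _
    have hψ : Measurable fun f : Finset.univ.erase j → ℝ => ∑ i, (f i - a i) ^ 2 := by fun_prop
    convert! (hind.indepFun_finset {j} (Finset.univ.erase j) (by simp) hξ).comp hφ hψ using 1
    ext ω
    exact (Finset.sum_coe_sort _ fun i => (ξ i ω - a i) ^ 2).symm
  have hsum (ω : Ω) : ∑ i, (ξ i ω - a i) ^ 2 = (ξ j ω - a j) ^ 2 + Y ω :=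
    (Finset.add_sum_erase _ _ (Finset.mem_univ j)).symm
  have hsum_update (ω : Ω) :
      ∑ i, (ξ i ω - Function.update a j 0 i) ^ 2 = ξ j ω ^ 2 + Y ω := by
    rw [← Finset.add_sum_erase _ _ (Finset.mem_univ j), Function.update_self, sub_zero]
    congr 1
    refine Finset.sum_congr rfl fun i hi => ?_
    rw [Function.update_of_ne (Finset.ne_of_mem_erase hi)]
  simp only [hsum, hsum_update]
  exact measure_sq_sub_add_lt_le (hξ j) (by fun_prop) hindY (hlaw j) (a j) s

lemma measure_sum_sq_sub_lt_le {ι : Type*} [Fintype ι] {ξ : ι → Ω → ℝ}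
    (hξ : ∀ i, Measurable (ξ i)) (hind : iIndepFun ξ P) {v : ι → NNReal}
    (hlaw : ∀ i, P.map (ξ i) = gaussianReal 0 (v i)) (a : ι → ℝ) (s : ℝ) :
    P {ω | ∑ i, (ξ i ω - a i) ^ 2 < s} ≤ P {ω | ∑ i, ξ i ω ^ 2 < s} := by
  classical
  have key (T : Finset ι) : P {ω | ∑ i, (ξ i ω - a i) ^ 2 < s}
      ≤ P {ω | ∑ i, (ξ i ω - T.piecewise (0 : ι → ℝ) a i) ^ 2 < s} := by
    induction T using Finset.induction_on with
    | empty => simp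
    | insert j T _ ih =>
      rw [Finset.piecewise_insert]
      exact ih.trans (measure_sum_sq_sub_lt_le_update hξ hind hlaw _ s j)
  simpa using key Finset.univ

end Anderson

lemma measure_ball_le_of_forall_lt {X : Type*} [PseudoMetricSpace X] [MeasurableSpace X]
    (ν : Measure X) {v : X} {r : ℝ} {C : ℝ≥0∞}
    (h : ∀ r' < r, ν (Metric.ball v r') ≤ C) : ν (Metric.ball v r) ≤ C := by
  obtain ⟨ρ, hρ_mono, hρ_lt, hρ_lim⟩ := exists_seq_strictMono_tendsto r
  have hU : Metric.ball v r = ⋃ n, Metric.ball v (ρ n) := by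
    ext x
    simp only [Set.mem_iUnion, Metric.mem_ball]
    exact ⟨fun hx => (hρ_lim.eventually_const_lt hx).exists, fun ⟨n, hn⟩ => hn.trans (hρ_lt n)⟩
  rw [hU, Monotone.measure_iUnion fun m n hmn => Metric.ball_subset_ball (hρ_mono.monotone hmn)]
  exact iSup_le fun n => h _ (hρ_lt n)

section Projections

variable {X : Type*} [NormedAddCommGroup X] [InnerProductSpace ℝ X]

lemma exists_orthonormalBasis_inner_apply_eq_zero {A : X →ₗ[ℝ] X} (hA : A.IsSymmetric)
    (V : Submodule ℝ X) [FiniteDimensional ℝ V] :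
    ∃ b : OrthonormalBasis (Fin (Module.finrank ℝ V)) ℝ V,
      ∀ i j, i ≠ j → ⟪A (b i), (b j : X)⟫_ℝ = 0 := by
  let T : V →ₗ[ℝ] V := (V.orthogonalProjectionOnto : X →ₗ[ℝ] V) ∘ₗ A ∘ₗ V.subtype
  have inner_T (x y : V) : ⟪T x, y⟫_ℝ = ⟪A x, (y : X)⟫_ℝ :=
    Submodule.inner_orthogonalProjectionOnto_eq_of_mem_right y _
  have hT : T.IsSymmetric := by
    intro x y
    rw [inner_T, real_inner_comm (T y), inner_T, real_inner_comm (x : X)]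
    exact hA x y
  refine ⟨hT.eigenvectorBasis rfl, fun i j hij => ?_⟩
  rw [← inner_T, hT.apply_eigenvectorBasis, inner_smul_left,
    (hT.eigenvectorBasis rfl).orthonormal.2 hij, mul_zero]

lemma norm_starProjection_sq_eq_sum {ι : Type*} [Fintype ι] {V : Submodule ℝ X}
    [V.HasOrthogonalProjection] (b : OrthonormalBasis ι ℝ V) (x : X) :
    ‖V.starProjection x‖ ^ 2 = ∑ i, ⟪(b i : X), x⟫_ℝ ^ 2 := by
  have h := b.sum_sq_norm_inner_right (V.orthogonalProjectionOnto x)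
  simp only [Submodule.inner_orthogonalProjectionOnto_eq_of_mem_left, Real.norm_eq_abs,
    sq_abs] at h
  exact h.symm

variable (X) in
lemma exists_monotone_finiteDimensional_tendsto_starProjection
    [TopologicalSpace.SeparableSpace X] :
    ∃ (U : ℕ → Submodule ℝ X) (_ : ∀ n, FiniteDimensional ℝ (U n)), Monotone U ∧
      ∀ x, Tendsto (fun n => (U n).starProjection x) atTop (𝓝 x) := by
  let U (n : ℕ) : Submodule ℝ X :=
    Submodule.span ℝ (Set.range fun i : Fin n => TopologicalSpace.denseSeq X i)
  have hfin (n : ℕ) : FiniteDimensional ℝ (U n) :=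
    FiniteDimensional.span_of_finite ℝ (Set.finite_range _)
  have hmono : Monotone U := by
    intro m n hmn
    refine Submodule.span_mono ?_
    rintro _ ⟨i, rfl⟩
    exact ⟨⟨i, i.2.trans_le hmn⟩, rfl⟩
  have hdense : ⊤ ≤ (⨆ n, U n).topologicalClosure := by
    intro x _
    refine closure_mono ?_ (TopologicalSpace.denseRange_denseSeq X x)
    rintro _ ⟨n, rfl⟩
    exact Submodule.mem_iSup_of_mem (n + 1) (Submodule.subset_span ⟨⟨n, n.lt_succ_self⟩, rfl⟩)
  exact ⟨U, hfin, hmono, fun x => Submodule.starProjection_tendsto_self U hmono x hdense⟩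

lemma norm_starProjection_apply_mono {V W : Submodule ℝ X} [V.HasOrthogonalProjection]
    [W.HasOrthogonalProjection] (h : V ≤ W) (x : X) :
    ‖V.starProjection x‖ ≤ ‖W.starProjection x‖ := by
  rw [← Submodule.starProjection_comp_starProjection_of_le h]
  exact Submodule.norm_starProjection_apply_le _ _

end Projections

section CovSqrt

variable {X : Type*} [NormedAddCommGroup X] [InnerProductSpace ℝ X] [CompleteSpace X]
  [MeasurableSpace X] [BorelSpace X]

lemma covSqrt_isPositive (μ : Measure X) : (covSqrt μ).IsPositive :=
  posSqrt_isPositive _ _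

lemma covSqrt_covSqrt (μ : Measure X) (x : X) :
    covSqrt μ (covSqrt μ x) = covarianceOperator μ x :=
  DFunLike.congr_fun (posSqrt_mul_self (covarianceOperator μ) _) x

lemma inner_covSqrt_left (μ : Measure X) (x y : X) :
    ⟪covSqrt μ x, y⟫_ℝ = ⟪x, covSqrt μ y⟫_ℝ :=
  (covSqrt_isPositive μ).isSymmetric x y

lemma covarianceOperator_inner_self (μ : Measure X) (x : X) :
    ⟪covarianceOperator μ x, x⟫_ℝ = ‖covSqrt μ x‖ ^ 2 := by
  rw [← covSqrt_covSqrt, inner_covSqrt_left, real_inner_self_eq_norm_sq]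

lemma covInvSqrt_mem_closure_range (μ : Measure X) (u : cameronMartin μ) :
    covInvSqrt μ u ∈ closure (Set.range (covSqrt μ)) := by
  have h := (covSqrt μ).orthogonal_ker
  rw [(covSqrt_isPositive μ).isSelfAdjoint.adjoint_eq] at h
  have hmem := covInvSqrt_mem μ u
  rw [h] at hmem
  exact hmem

end CovSqrt

section CenteredGaussian

variable {X : Type*} [NormedAddCommGroup X] [InnerProductSpace ℝ X] [CompleteSpace X]
  [SecondCountableTopology X] [MeasurableSpace X] [BorelSpace X] {μ : Measure X} [IsGaussian μ]

lemma integral_inner_eq_zero (hμ : ∫ x, x ∂μ = 0) (w : X) : ∫ x, ⟪w, x⟫_ℝ ∂μ = 0 := by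
  simpa [hμ] using integral_inner (𝕜 := ℝ) (IsGaussian.integrable_id (μ := μ)) w

lemma covariance_inner (hμ : ∫ x, x ∂μ = 0) (w w' : X) :
    cov[fun x => ⟪w, x⟫_ℝ, fun x => ⟪w', x⟫_ℝ; μ] = ⟪covarianceOperator μ w, w'⟫_ℝ := by
  have hLp (z : X) : MemLp (fun x => ⟪z, x⟫_ℝ) 2 μ := IsGaussian.memLp_two_id.const_inner z
  rw [covariance_eq_sub (hLp w) (hLp w'), integral_inner_eq_zero hμ, zero_mul, sub_zero,
    covarianceOperator_inner IsGaussian.memLp_two_id]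
  rfl

lemma map_inner_eq_gaussianReal (hμ : ∫ x, x ∂μ = 0) (w : X) :
    μ.map (fun x => ⟪w, x⟫_ℝ) = gaussianReal 0 (‖covSqrt μ w‖ ^ 2).toNNReal := by
  have h : HasGaussianLaw (fun x => ⟪w, x⟫_ℝ) μ :=
    (IsGaussian.hasGaussianLaw_id (μ := μ)).map (innerSL ℝ w)
  rw [h.map_eq_gaussianReal, integral_inner_eq_zero hμ, ← covariance_self (by fun_prop),
    covariance_inner hμ, covarianceOperator_inner_self]

lemma measure_sum_inner_sub_sq_lt_le (hμ : ∫ x, x ∂μ = 0) {ι : Type*} [Fintype ι] (f : ι → X)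
    (hf : ∀ i j, i ≠ j → ⟪covarianceOperator μ (f i), f j⟫_ℝ = 0) (a : ι → ℝ) (s : ℝ) :
    μ {x | ∑ i, (⟪f i, x⟫_ℝ - a i) ^ 2 < s} ≤ μ {x | ∑ i, ⟪f i, x⟫_ℝ ^ 2 < s} := by
  have hind : iIndepFun (fun i x => ⟪f i, x⟫_ℝ) μ := by
    refine HasGaussianLaw.iIndepFun_of_covariance_eq_zero ?_ fun i j hij => ?_
    · exact (IsGaussian.hasGaussianLaw_id (μ := μ)).map
        (ContinuousLinearMap.pi fun i => innerSL ℝ (f i))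
    · rw [covariance_inner hμ, hf i j hij]
  exact measure_sum_sq_sub_lt_le (fun i => by fun_prop) hind
    (fun i => map_inner_eq_gaussianReal hμ (f i)) a s

lemma measure_norm_starProjection_sub_lt_le (hμ : ∫ x, x ∂μ = 0) (V : Submodule ℝ X)
    [FiniteDimensional ℝ V] (v : X) {r : ℝ} (hr : 0 ≤ r) :
    μ {x | ‖V.starProjection (x - v)‖ < r} ≤ μ {x | ‖V.starProjection x‖ < r} := by
  obtain ⟨b, hb⟩ := exists_orthonormalBasis_inner_apply_eq_zero
    (isPositive_covarianceOperator (μ := μ)).isSymmetric V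
  have hlt (x : X) : ‖V.starProjection x‖ < r ↔ ∑ i, ⟪(b i : X), x⟫_ℝ ^ 2 < r ^ 2 := by
    rw [← norm_starProjection_sq_eq_sum, sq_lt_sq₀ (norm_nonneg _) hr]
  simp only [hlt, inner_sub_right]
  exact measure_sum_inner_sub_sq_lt_le hμ _ hb _ _

theorem measure_ball_le_measure_ball_zero (hμ : ∫ x, x ∂μ = 0) (v : X) (r : ℝ) :
    μ (Metric.ball v r) ≤ μ (Metric.ball 0 r) := by
  obtain ⟨U, hfin, hU, hlim⟩ := exists_monotone_finiteDimensional_tendsto_starProjection X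
  refine measure_ball_le_of_forall_lt μ fun r' hr' => ?_
  rcases lt_or_ge r' 0 with hneg | hnonneg
  · simp [Metric.ball_eq_empty.2 hneg.le]
  have hle (n : ℕ) : μ (Metric.ball v r') ≤ μ {x | ‖(U n).starProjection x‖ < r'} :=
    calc μ (Metric.ball v r') ≤ μ {x | ‖(U n).starProjection (x - v)‖ < r'} :=
          measure_mono fun x hx =>
            (Submodule.norm_starProjection_apply_le _ _).trans_lt (mem_ball_iff_norm.1 hx)
      _ ≤ _ := measure_norm_starProjection_sub_lt_le hμ (U n) v hnonneg
  have htendsto := tendsto_measure_iInter_atTop (μ := μ)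
    (s := fun n => {x | ‖(U n).starProjection x‖ < r'})
    (fun n => (measurableSet_lt (by fun_prop) (by fun_prop)).nullMeasurableSet)
    (fun m n hmn x hx => (norm_starProjection_apply_mono (hU hmn) x).trans_lt hx)
    ⟨0, measure_ne_top _ _⟩
  refine (ge_of_tendsto' htendsto hle).trans (measure_mono fun x hx => ?_)
  rw [mem_ball_zero_iff]
  exact (le_of_tendsto' (hlim x).norm fun n => (Set.mem_iInter.1 hx n).le).trans_lt hr'

lemma measure_ball_zero_pos (hμ : ∫ x, x ∂μ = 0) {r : ℝ} (hr : 0 < r) :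
    0 < μ (Metric.ball 0 r) := by
  by_contra! h
  have hnull (v : X) : μ (Metric.ball v r) = 0 :=
    le_antisymm ((measure_ball_le_measure_ball_zero hμ v r).trans h) zero_le
  have huniv : μ Set.univ = 0 := measure_null_of_locally_null _ fun x _ =>
    ⟨Metric.ball x r, mem_nhdsWithin_of_mem_nhds (Metric.ball_mem_nhds x hr), hnull x⟩
  simp at huniv

lemma map_neg_eq_self (hμ : ∫ x, x ∂μ = 0) : μ.map (fun x => -x) = μ := by
  have : IsProbabilityMeasure (μ.map fun x => -x) :=
    Measure.isProbabilityMeasure_map (by fun_prop)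
  refine Measure.ext_of_charFun ?_
  ext t
  have h : HasGaussianLaw (fun x : X => -x) μ := (IsGaussian.hasGaussianLaw_id (μ := μ)).neg
  rw [h.charFun_map_eq, IsGaussian.charFun_eq, integral_complex_ofReal]
  simp only [inner_neg_right, integral_neg, integral_inner_eq_zero hμ t, neg_zero,
    variance_fun_neg]

lemma measure_ball_neg (hμ : ∫ x, x ∂μ = 0) (v : X) (r : ℝ) :
    μ (Metric.ball (-v) r) = μ (Metric.ball v r) := by
  conv_lhs => rw [← map_neg_eq_self hμ, Measure.map_apply measurable_neg measurableSet_ball]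
  congr 1
  ext x
  simp only [Set.mem_preimage, Metric.mem_ball, dist_neg_neg]

end CenteredGaussian

section CameronMartinFormula

variable {X : Type*} [NormedAddCommGroup X] [InnerProductSpace ℝ X] [CompleteSpace X]
  [SecondCountableTopology X] [MeasurableSpace X] [BorelSpace X]

lemma ext_of_integral_exp_inner {P Q : Measure X} [IsProbabilityMeasure P]
    [IsProbabilityMeasure Q] (hP : ∀ w, Integrable (fun x => Real.exp ⟪w, x⟫_ℝ) P)
    (h : ∀ w, ∫ x, Real.exp ⟪w, x⟫_ℝ ∂P = ∫ x, Real.exp ⟪w, x⟫_ℝ ∂Q) : P = Q := by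
  have charFun_eq (R : Measure X) (t : X) :
      charFun R t = complexMGF (fun x => ⟪t, x⟫_ℝ) R Complex.I := by
    simp only [charFun_apply, complexMGF, real_inner_comm t, mul_comm Complex.I]
  refine Measure.ext_of_charFun (funext fun t => ?_)
  have hmgf : mgf (fun x => ⟪t, x⟫_ℝ) P = mgf (fun x => ⟪t, x⟫_ℝ) Q := by
    ext τ
    simpa only [mgf, inner_smul_left, conj_trivial] using h (τ • t)
  have hset : integrableExpSet (fun x => ⟪t, x⟫_ℝ) P = Set.univ := by
    ext τ
    simpa only [integrableExpSet, Set.mem_ofPred_eq, Set.mem_univ, iff_true, inner_smul_left,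
      conj_trivial] using hP (τ • t)
  rw [charFun_eq, charFun_eq]
  exact eqOn_complexMGF_of_mgf hmgf (by simp [hset])

variable {μ : Measure X} [IsGaussian μ]

lemma integrable_exp_inner (hμ : ∫ x, x ∂μ = 0) (w : X) :
    Integrable (fun x => Real.exp ⟪w, x⟫_ℝ) μ := by
  have h := integrable_exp_mul_gaussianReal (μ := 0) (v := (‖covSqrt μ w‖ ^ 2).toNNReal) 1
  rw [← map_inner_eq_gaussianReal hμ w, integrable_map_measure (by fun_prop) (by fun_prop)] at h
  simpa only [Function.comp_def, one_mul] using h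

lemma integral_exp_inner (hμ : ∫ x, x ∂μ = 0) (w : X) :
    ∫ x, Real.exp ⟪w, x⟫_ℝ ∂μ = Real.exp (‖covSqrt μ w‖ ^ 2 / 2) := by
  have h := mgf_gaussianReal (map_inner_eq_gaussianReal hμ w) 1
  rw [Real.coe_toNNReal _ (sq_nonneg _)] at h
  simpa [mgf] using h

/-- The Cameron-Martin formula, by comparison of Laplace transforms. -/
theorem tilted_inner_eq_map_add_covarianceOperator (hμ : ∫ x, x ∂μ = 0) (w : X) :
    μ.tilted (fun x => ⟪w, x⟫_ℝ) = μ.map (fun x => x + covarianceOperator μ w) := by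
  have hw := integrable_exp_inner hμ w
  have inner_comm (t : X) : ⟪covSqrt μ w, covSqrt μ t⟫_ℝ = ⟪t, covarianceOperator μ w⟫_ℝ := by
    rw [real_inner_comm, inner_covSqrt_left, covSqrt_covSqrt]
  have : IsProbabilityMeasure (μ.tilted fun x => ⟪w, x⟫_ℝ) := isProbabilityMeasure_tilted hw
  have : IsProbabilityMeasure (μ.map fun x => x + covarianceOperator μ w) :=
    Measure.isProbabilityMeasure_map (by fun_prop)
  refine (ext_of_integral_exp_inner (fun t => ?_) fun t => ?_).symm
  · rw [integrable_map_measure (by fun_prop) (by fun_prop)]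
    simp only [Function.comp_def, inner_add_right, Real.exp_add]
    exact (integrable_exp_inner hμ t).mul_const _
  · rw [integral_exp_tilted, integral_map (by fun_prop) (by fun_prop)]
    simp only [Pi.add_apply, ← inner_add_left, inner_add_right, Real.exp_add, integral_mul_const]
    rw [integral_exp_inner hμ, integral_exp_inner hμ, integral_exp_inner hμ, ← Real.exp_add,
      ← Real.exp_sub, map_add, norm_add_sq_real, inner_comm]
    ring_nf

lemma measure_ball_sub_covarianceOperator (hμ : ∫ x, x ∂μ = 0) (v w : X) (r : ℝ) :
    μ (Metric.ball (v - covarianceOperator μ w) r)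
      = ENNReal.ofReal (Real.exp (-(‖covSqrt μ w‖ ^ 2 / 2))) *
          ∫⁻ x in Metric.ball v r, ENNReal.ofReal (Real.exp ⟪w, x⟫_ℝ) ∂μ := by
  have hpre : Metric.ball (v - covarianceOperator μ w) r
      = (fun x => x + covarianceOperator μ w) ⁻¹' Metric.ball v r := by
    ext x
    simp only [Set.mem_preimage, mem_ball_iff_norm]
    rw [sub_sub_eq_add_sub]
  rw [hpre, ← Measure.map_apply (by fun_prop) measurableSet_ball,
    ← tilted_inner_eq_map_add_covarianceOperator hμ, tilted_apply' _ _ measurableSet_ball,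
    integral_exp_inner hμ, ← lintegral_const_mul _ (by fun_prop)]
  refine lintegral_congr fun x => ?_
  rw [← ENNReal.ofReal_mul (Real.exp_nonneg _), div_eq_inv_mul, Real.exp_neg]

lemma measure_ball_le_exp (hμ : ∫ x, x ∂μ = 0) (v w : X) (r : ℝ) :
    μ (Metric.ball v r) ≤ ENNReal.ofReal (Real.exp
      (‖covSqrt μ w‖ ^ 2 / 2 - ⟪w, v⟫_ℝ + r * ‖w‖)) * μ (Metric.ball 0 r) := by
  let c : X := v - covarianceOperator μ w
  have inner_le (x : X) (hx : x ∈ Metric.ball c r) :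
      ⟪-w, x⟫_ℝ ≤ ‖covSqrt μ w‖ ^ 2 - ⟪w, v⟫_ℝ + r * ‖w‖ := by
    have hcauchy := real_inner_le_norm w (c - x)
    have hdist := mul_le_mul_of_nonneg_right (mem_ball_iff_norm'.1 hx).le (norm_nonneg w)
    rw [inner_sub_right, inner_sub_right, real_inner_comm (covarianceOperator μ w),
      covarianceOperator_inner_self] at hcauchy
    rw [inner_neg_left]
    linarith
  calc μ (Metric.ball v r)
      = ENNReal.ofReal (Real.exp (-(‖covSqrt μ w‖ ^ 2 / 2))) *
          ∫⁻ x in Metric.ball c r, ENNReal.ofReal (Real.exp ⟪-w, x⟫_ℝ) ∂μ := by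
        simpa [c] using measure_ball_sub_covarianceOperator hμ c (-w) r
    _ ≤ ENNReal.ofReal (Real.exp (-(‖covSqrt μ w‖ ^ 2 / 2))) *
          (ENNReal.ofReal (Real.exp (‖covSqrt μ w‖ ^ 2 - ⟪w, v⟫_ℝ + r * ‖w‖)) *
            μ (Metric.ball 0 r)) := by
        gcongr
        refine (setLIntegral_mono measurable_const fun x hx =>
          ENNReal.ofReal_le_ofReal (Real.exp_le_exp.2 (inner_le x hx))).trans ?_
        rw [setLIntegral_const]
        exact mul_le_mul_right (measure_ball_le_measure_ball_zero hμ c r) _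
    _ = _ := by
        rw [← mul_assoc, ← ENNReal.ofReal_mul (Real.exp_nonneg _), ← Real.exp_add]
        ring_nf

lemma exp_mul_measure_ball_zero_le_of_covarianceOperator (hμ : ∫ x, x ∂μ = 0) (w : X) (r : ℝ) :
    ENNReal.ofReal (Real.exp (-(‖covSqrt μ w‖ ^ 2 / 2))) * μ (Metric.ball 0 r)
      ≤ μ (Metric.ball (covarianceOperator μ w) r) := by
  have hminus := measure_ball_sub_covarianceOperator hμ 0 w r
  have hplus := measure_ball_sub_covarianceOperator hμ 0 (-w) r
  simp only [zero_sub, map_neg, norm_neg, neg_neg, inner_neg_left, measure_ball_neg hμ]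
    at hminus hplus
  refine (ENNReal.mul_le_mul_iff_right two_ne_zero ENNReal.ofNat_ne_top).1 ?_
  have hcosh : 2 * μ (Metric.ball 0 r)
      ≤ (∫⁻ x in Metric.ball 0 r, ENNReal.ofReal (Real.exp ⟪w, x⟫_ℝ) ∂μ)
        + ∫⁻ x in Metric.ball 0 r, ENNReal.ofReal (Real.exp (-⟪w, x⟫_ℝ)) ∂μ := by
    rw [← lintegral_add_left (by fun_prop), ← setLIntegral_const]
    refine lintegral_mono fun x => ?_
    simp only
    rw [← ENNReal.ofReal_add (Real.exp_nonneg _) (Real.exp_nonneg _), ← ENNReal.ofReal_ofNat]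
    refine ENNReal.ofReal_le_ofReal ?_
    linarith [Real.add_one_le_exp ⟪w, x⟫_ℝ, Real.add_one_le_exp (-⟪w, x⟫_ℝ)]
  calc 2 * (ENNReal.ofReal (Real.exp (-(‖covSqrt μ w‖ ^ 2 / 2))) * μ (Metric.ball 0 r))
      = ENNReal.ofReal (Real.exp (-(‖covSqrt μ w‖ ^ 2 / 2))) * (2 * μ (Metric.ball 0 r)) :=
        mul_left_comm _ _ _
    _ ≤ _ := mul_le_mul_right hcosh _
    _ = 2 * μ (Metric.ball (covarianceOperator μ w) r) := by
        rw [mul_add, ← hminus, ← hplus, two_mul]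

lemma exp_mul_measure_ball_zero_le (hμ : ∫ x, x ∂μ = 0) (u : cameronMartin μ) (r : ℝ) :
    ENNReal.ofReal (Real.exp (-(cameronMartinNorm μ u ^ 2 / 2))) * μ (Metric.ball 0 r)
      ≤ μ (Metric.ball (u : X) r) := by
  obtain ⟨y, hy, hlim⟩ := mem_closure_iff_seq_limit.1 (covInvSqrt_mem_closure_range μ u)
  choose w hw using hy
  obtain rfl : (fun n => covSqrt μ (w n)) = y := funext hw
  have hlim_u : Tendsto (fun n => covarianceOperator μ (w n)) atTop (𝓝 (u : X)) := by
    simpa only [Function.comp_def, covSqrt_covSqrt, covSqrt_covInvSqrt] using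
      ((covSqrt μ).continuous.tendsto _).comp hlim
  have hlim_exp :
      Tendsto (fun n => ENNReal.ofReal (Real.exp (-(‖covSqrt μ (w n)‖ ^ 2 / 2)))) atTop
        (𝓝 (ENNReal.ofReal (Real.exp (-(cameronMartinNorm μ u ^ 2 / 2))))) :=
    ENNReal.tendsto_ofReal (((hlim.norm.pow 2).div_const 2).neg.rexp)
  refine measure_ball_le_of_forall_lt
    (ENNReal.ofReal (Real.exp (-(cameronMartinNorm μ u ^ 2 / 2))) • μ) fun r' hr' => ?_
  refine le_of_tendsto (ENNReal.Tendsto.mul_const hlim_exp (Or.inr (measure_ne_top _ _))) ?_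
  filter_upwards [Metric.tendsto_nhds.1 hlim_u (r - r') (sub_pos.2 hr')] with n hn
  refine (exp_mul_measure_ball_zero_le_of_covarianceOperator hμ (w n) r').trans
    (measure_mono (Metric.ball_subset_ball' ?_))
  linarith

end CameronMartinFormula

section WeakCompactness

variable {X : Type*} [NormedAddCommGroup X] [InnerProductSpace ℝ X]

lemma norm_sq_le_of_tendsto_inner {x : ℕ → X} {z : X}
    (hz : Tendsto (fun n => ⟪x n, z⟫_ℝ) atTop (𝓝 ⟪z, z⟫_ℝ)) {b : ℕ → ℝ} {B : ℝ}
    (hb : Tendsto b atTop (𝓝 B)) (h : ∀ᶠ n in atTop, ‖x n‖ ^ 2 ≤ b n) : ‖z‖ ^ 2 ≤ B := by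
  have hle : 2 * ⟪z, z⟫_ℝ - ‖z‖ ^ 2 ≤ B := by
    refine le_of_tendsto_of_tendsto ((hz.const_mul 2).sub_const _) hb (h.mono fun n hn => ?_)
    linarith [norm_sub_sq_real (x n) z, sq_nonneg ‖x n - z‖]
  rw [real_inner_self_eq_norm_sq] at hle
  linarith

variable [CompleteSpace X]

lemma exists_subseq_tendsto_inner [TopologicalSpace.SeparableSpace X] {x : ℕ → X} {R : ℝ}
    (hx : ∀ n, ‖x n‖ ≤ R) :
    ∃ z, ∃ φ : ℕ → ℕ, StrictMono φ ∧
      ∀ w, Tendsto (fun n => ⟪x (φ n), w⟫_ℝ) atTop (𝓝 ⟪z, w⟫_ℝ) := by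
  obtain ⟨f, -, φ, hφ, hlim⟩ := WeakDual.isSeqCompact_closedBall ℝ X 0 R
    (x := fun n => StrongDual.toWeakDual (InnerProductSpace.toDual ℝ X (x n))) fun n => by
      simpa using hx n
  refine ⟨(InnerProductSpace.toDual ℝ X).symm (WeakDual.toStrongDual f), φ, hφ, fun w => ?_⟩
  rw [InnerProductSpace.toDual_symm_apply]
  exact ((WeakDual.eval_continuous w).tendsto f).comp hlim

variable [MeasurableSpace X] [BorelSpace X] {μ : Measure X}

lemma norm_covSqrt_sq (hμ : MemLp id 2 μ) (w : X) :
    ‖covSqrt μ w‖ ^ 2 = ∫ x, ⟪w, x⟫_ℝ ^ 2 ∂μ := by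
  rw [← covarianceOperator_inner_self, covarianceOperator_inner hμ]
  simp only [sq]

lemma tendsto_covSqrt_of_tendsto_inner (hμ : MemLp id 2 μ) {x : ℕ → X} {z : X} {R : ℝ}
    (hx : ∀ n, ‖x n‖ ≤ R) (hlim : ∀ w, Tendsto (fun n => ⟪x n, w⟫_ℝ) atTop (𝓝 ⟪z, w⟫_ℝ)) :
    Tendsto (fun n => covSqrt μ (x n)) atTop (𝓝 (covSqrt μ z)) := by
  suffices h : Tendsto (fun n => ‖covSqrt μ (x n - z)‖ ^ 2) atTop (𝓝 0) by
    rw [tendsto_iff_norm_sub_tendsto_zero]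
    simpa [Real.sqrt_sq (norm_nonneg _)] using h.sqrt
  simp only [norm_covSqrt_sq hμ]
  have hle (n : ℕ) (w : X) : ‖⟪x n - z, w⟫_ℝ ^ 2‖ ≤ (R + ‖z‖) ^ 2 * ‖w‖ ^ 2 := by
    rw [norm_pow, ← mul_pow]
    gcongr
    refine (norm_inner_le_norm _ _).trans ?_
    gcongr
    exact (norm_sub_le _ _).trans (by gcongr; exact hx n)
  have hint : Integrable (fun w => (R + ‖z‖) ^ 2 * ‖w‖ ^ 2) μ :=
    (hμ.integrable_norm_pow two_ne_zero).const_mul _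
  have hzero (w : X) : Tendsto (fun n => ⟪x n - z, w⟫_ℝ ^ 2) atTop (𝓝 0) := by
    simpa [inner_sub_left] using ((hlim w).sub_const ⟪z, w⟫_ℝ).pow 2
  simpa using tendsto_integral_of_dominated_convergence _
    (fun n => (by fun_prop : Continuous fun w => ⟪x n - z, w⟫_ℝ ^ 2).aestronglyMeasurable) hint
    (fun n => ae_of_all _ (hle n)) (ae_of_all _ hzero)

lemma exists_subseq_tendsto_of_sq_add_div_le [TopologicalSpace.SeparableSpace X]
    (hμ : MemLp id 2 μ) {x v : ℕ → X} {r : ℕ → ℝ} (hr_pos : ∀ n, 0 < r n)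
    (hr : Tendsto r atTop (𝓝 0)) {C : ℝ}
    (hC : ∀ n, ‖x n‖ ^ 2 + ‖v n - covSqrt μ (x n)‖ ^ 2 / r n ≤ C) :
    ∃ z, ∃ φ : ℕ → ℕ, StrictMono φ ∧ (∀ w, Tendsto (fun n => ⟪x (φ n), w⟫_ℝ) atTop (𝓝 ⟪z, w⟫_ℝ)) ∧
      Tendsto (v ∘ φ) atTop (𝓝 (covSqrt μ z)) := by
  have hx (n : ℕ) : ‖x n‖ ≤ √C := Real.le_sqrt_of_sq_le <|
    (le_add_of_nonneg_right (div_nonneg (sq_nonneg _) (hr_pos n).le)).trans (hC n)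
  obtain ⟨z, φ, hφ, hz⟩ := exists_subseq_tendsto_inner hx
  have hresidual : Tendsto (fun n => v n - covSqrt μ (x n)) atTop (𝓝 0) := by
    rw [tendsto_zero_iff_norm_tendsto_zero]
    suffices h : Tendsto (fun n => ‖v n - covSqrt μ (x n)‖ ^ 2) atTop (𝓝 0) by
      simpa [Real.sqrt_sq (norm_nonneg _)] using h.sqrt
    refine squeeze_zero (fun n => sq_nonneg _) (fun n => ?_) (by simpa using hr.const_mul C)
    rw [← div_le_iff₀ (hr_pos n)]
    exact (le_add_of_nonneg_left (sq_nonneg _)).trans (hC n)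
  refine ⟨z, φ, hφ, hz, ?_⟩
  simpa [Function.comp_def] using (hresidual.comp hφ.tendsto_atTop).add
    (tendsto_covSqrt_of_tendsto_inner hμ (fun n => hx (φ n)) hz)

end WeakCompactness

section Regularisation

variable {X : Type*} [NormedAddCommGroup X] [InnerProductSpace ℝ X] [CompleteSpace X]

lemma exists_apply_add_smul_eq {T : X →L[ℝ] X} (hT : T.IsPositive) {r : ℝ} (hr : 0 < r) (v : X) :
    ∃ w, T w + r • w = v := by
  have hunit : IsUnit (T + r • ContinuousLinearMap.id ℝ X) := by
    refine ContinuousLinearMap.isUnit_of_forall_le_norm_inner_map _ (c := r.toNNReal)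
      (Real.toNNReal_pos.2 hr) fun x => ?_
    have hinner : ⟪(T + r • ContinuousLinearMap.id ℝ X) x, x⟫_ℝ = ⟪T x, x⟫_ℝ + r * ‖x‖ ^ 2 := by
      simp [inner_add_left, inner_smul_left]
    rw [hinner, Real.coe_toNNReal _ hr.le, Real.norm_eq_abs]
    linarith [le_abs_self (⟪T x, x⟫_ℝ + r * ‖x‖ ^ 2), hT.inner_nonneg_left x]
  exact (ContinuousLinearMap.isUnit_iff_bijective.1 hunit).surjective v

variable [SecondCountableTopology X] [MeasurableSpace X] [BorelSpace X]
  {μ : Measure X} [IsGaussian μ]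

/-- Take `x = K ^ (1 / 2) w` with `(K + r) w = v`, so that `v - K ^ (1 / 2) x = r w`. -/
lemma exists_measure_ball_le_exp (hμ : ∫ x, x ∂μ = 0) {r : ℝ} (hr : 0 < r) (v : X) :
    ∃ x, μ (Metric.ball v r) ≤ ENNReal.ofReal (Real.exp
      (-((‖x‖ ^ 2 + ‖v - covSqrt μ x‖ ^ 2 / r) / 2) + r / 2)) * μ (Metric.ball 0 r) := by
  obtain ⟨w, hw⟩ := exists_apply_add_smul_eq
    ((ContinuousLinearMap.isPositive_toLinearMap_iff _).1 (isPositive_covarianceOperator (μ := μ)))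
    hr v
  have hinner : ⟪w, v⟫_ℝ = ‖covSqrt μ w‖ ^ 2 + r * ‖w‖ ^ 2 := by
    rw [← hw, real_inner_comm, inner_add_left, covarianceOperator_inner_self, inner_smul_left,
      real_inner_self_eq_norm_sq, conj_trivial]
  have hresidual : ‖v - covSqrt μ (covSqrt μ w)‖ ^ 2 / r = r * ‖w‖ ^ 2 := by
    rw [covSqrt_covSqrt, ← hw, add_sub_cancel_left, norm_smul, Real.norm_of_nonneg hr.le]
    field_simp
  refine ⟨covSqrt μ w, (measure_ball_le_exp hμ v w r).trans ?_⟩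
  rw [hresidual, hinner]
  refine mul_le_mul_left (ENNReal.ofReal_le_ofReal (Real.exp_le_exp.2 ?_)) _
  nlinarith [mul_nonneg hr.le (sq_nonneg (‖w‖ - 1))]

end Regularisation

section Energy

variable {X : Type*} [NormedAddCommGroup X] [InnerProductSpace ℝ X] [CompleteSpace X]
  [MeasurableSpace X] [BorelSpace X]

lemma cameronMartinNorm_le (μ : Measure X) {u : cameronMartin μ} {x : X}
    (hx : covSqrt μ x = u) : cameronMartinNorm μ u ≤ ‖x‖ := by
  have hker : x - covInvSqrt μ u ∈ LinearMap.ker (covSqrt μ : X →ₗ[ℝ] X) := by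
    simp [hx, covSqrt_covInvSqrt]
  have horth := Submodule.inner_right_of_mem_orthogonal hker (covInvSqrt_mem μ u)
  have hpyth := norm_add_sq_eq_norm_sq_add_norm_sq_of_inner_eq_zero _ _ horth
  rw [sub_add_cancel] at hpyth
  exact le_of_sq_le_sq (by rw [cameronMartinNorm]; nlinarith [hpyth]) (norm_nonneg x)

/-- The Onsager-Machlup functional `Φ u + ‖u‖²_{H(μ)} / 2` of a potential `Φ`, as a real-valued
function on the Cameron-Martin space, outside of which it is infinite. -/
noncomputable def cameronMartinEnergy (μ : Measure X) (Φ : X → ℝ) (u : cameronMartin μ) : ℝ :=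
  Φ u + cameronMartinNorm μ u ^ 2 / 2

end Energy

section SmallBalls

/-- The measure with density `exp (-Φ)` with respect to `μ`, not normalized. -/
noncomputable def expWeighted {X : Type*} [MeasurableSpace X] (μ : Measure X) (Φ : X → ℝ) :
    Measure X :=
  μ.withDensity fun x => ENNReal.ofReal (Real.exp (-Φ x))

lemma expWeighted_le {X : Type*} [MeasurableSpace X] (μ : Measure X) {Φ : X → ℝ} {s : Set X}
    (hs : MeasurableSet s) {p : ℝ} (hp : ∀ x ∈ s, p ≤ Φ x) :
    expWeighted μ Φ s ≤ ENNReal.ofReal (Real.exp (-p)) * μ s := by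
  rw [expWeighted, withDensity_apply _ hs, ← setLIntegral_const]
  refine setLIntegral_mono measurable_const fun x hx => ?_
  gcongr
  exact hp x hx

lemma le_expWeighted {X : Type*} [MeasurableSpace X] (μ : Measure X) {Φ : X → ℝ}
    {s : Set X} (hs : MeasurableSet s) {p : ℝ} (hp : ∀ x ∈ s, Φ x ≤ p) :
    ENNReal.ofReal (Real.exp (-p)) * μ s ≤ expWeighted μ Φ s := by
  rw [expWeighted, withDensity_apply _ hs, ← setLIntegral_const]
  refine setLIntegral_mono' hs fun x hx => ?_
  gcongr
  exact hp x hx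

variable {X : Type*} [NormedAddCommGroup X] [InnerProductSpace ℝ X] [CompleteSpace X]
  [SecondCountableTopology X] [MeasurableSpace X] [BorelSpace X] {μ : Measure X} [IsGaussian μ]
  {Φ : X → ℝ} {a : ℝ}

lemma eventually_le_expWeighted_ball (hμ : ∫ x, x ∂μ = 0) (hΦ : Continuous Φ)
    {u : cameronMartin μ} (ha : cameronMartinEnergy μ Φ u < a) :
    ∀ᶠ r in 𝓝[>] (0 : ℝ), ENNReal.ofReal (Real.exp (-a)) * μ (Metric.ball 0 r)
      ≤ expWeighted μ Φ (Metric.ball (u : X) r) := by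
  set c := cameronMartinNorm μ u ^ 2 / 2
  obtain ⟨δ, hδ, hball⟩ := Metric.mem_nhds_iff.1
    (hΦ.continuousAt.eventually_lt_const (lt_sub_iff_add_lt.2 ha))
  filter_upwards [nhdsWithin_le_nhds (gt_mem_nhds hδ)] with r hr
  calc ENNReal.ofReal (Real.exp (-a)) * μ (Metric.ball 0 r)
      = ENNReal.ofReal (Real.exp (-(a - c)))
          * (ENNReal.ofReal (Real.exp (-c)) * μ (Metric.ball 0 r)) := by
        rw [← mul_assoc, ← ENNReal.ofReal_mul (Real.exp_nonneg _), ← Real.exp_add]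
        ring_nf
    _ ≤ ENNReal.ofReal (Real.exp (-(a - c))) * μ (Metric.ball (u : X) r) :=
        mul_le_mul_right (exp_mul_measure_ball_zero_le hμ u r) _
    _ ≤ expWeighted μ Φ (Metric.ball (u : X) r) :=
        le_expWeighted μ measurableSet_ball fun x hx =>
          (hball (Metric.ball_subset_ball hr.le hx)).le

lemma exists_add_le_of_le_expWeighted_ball (hμ : ∫ x, x ∂μ = 0) {r : ℝ} (hr : 0 < r) {v : X}
    (h : ENNReal.ofReal (Real.exp (-a)) * μ (Metric.ball 0 r)
      ≤ expWeighted μ Φ (Metric.ball v r)) :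
    ∃ x, ∀ p, (∀ z ∈ Metric.ball v r, p ≤ Φ z) →
      p + (‖x‖ ^ 2 + ‖v - covSqrt μ x‖ ^ 2 / r) / 2 ≤ a + r / 2 := by
  obtain ⟨x, hx⟩ := exists_measure_ball_le_exp hμ hr v
  refine ⟨x, fun p hp => ?_⟩
  have hle := (h.trans (expWeighted_le μ measurableSet_ball hp)).trans (mul_le_mul_right hx _)
  rw [← mul_assoc, ← ENNReal.ofReal_mul (Real.exp_nonneg _), ← Real.exp_add,
    ENNReal.mul_le_mul_iff_left (measure_ball_zero_pos hμ hr).ne' (measure_ne_top _ _),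
    ENNReal.ofReal_le_ofReal_iff (Real.exp_nonneg _), Real.exp_le_exp] at hle
  linarith

lemma exists_subseq_tendsto_of_le_expWeighted_ball (hμ : ∫ x, x ∂μ = 0) (hΦ : Continuous Φ)
    (hbdd : BddBelow (Set.range Φ)) {r : ℕ → ℝ} (hr_pos : ∀ n, 0 < r n)
    (hr : Tendsto r atTop (𝓝 0)) {v : ℕ → X}
    (h : ∀ n, ENNReal.ofReal (Real.exp (-a)) * μ (Metric.ball 0 (r n))
      ≤ expWeighted μ Φ (Metric.ball (v n) (r n))) :
    ∃ u : cameronMartin μ, cameronMartinEnergy μ Φ u ≤ a ∧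
      ∃ φ : ℕ → ℕ, StrictMono φ ∧ Tendsto (v ∘ φ) atTop (𝓝 (u : X)) := by
  choose x hx using fun n => exists_add_le_of_le_expWeighted_ball hμ (hr_pos n) (h n)
  obtain ⟨q, hq⟩ := hbdd
  obtain ⟨R, hR⟩ := hr.bddAbove_range
  obtain ⟨z, φ, hφ, hz, hv⟩ := exists_subseq_tendsto_of_sq_add_div_le
    (IsGaussian.memLp_two_id (μ := μ)) (x := x) (v := v) hr_pos hr (C := 2 * (a - q) + R)
    fun n => by linarith [hx n q fun z _ => hq ⟨z, rfl⟩, hR ⟨n, rfl⟩]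
  have hrφ := hr.comp hφ.tendsto_atTop
  have hle_a (p : ℝ) (hp : p < Φ (covSqrt μ z)) : p + ‖z‖ ^ 2 / 2 ≤ a := by
    obtain ⟨δ, hδ, hball⟩ := Metric.mem_nhds_iff.1 (hΦ.continuousAt.eventually_const_lt hp)
    have hball_φ : ∀ᶠ n in atTop, r (φ n) + dist (v (φ n)) (covSqrt μ z) < δ :=
      (hrφ.add (tendsto_iff_dist_tendsto_zero.1 hv)).eventually_lt_const (by simpa using hδ)
    suffices h : ‖z‖ ^ 2 ≤ 2 * (a - p) + 0 by linarith
    refine norm_sq_le_of_tendsto_inner (hz z) (hrφ.const_add _) (hball_φ.mono fun n hn => ?_)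
    have hφn := hx (φ n) p fun y hy => (hball (Metric.ball_subset_ball' hn.le hy)).le
    have hnonneg := div_nonneg (sq_nonneg ‖v (φ n) - covSqrt μ (x (φ n))‖) (hr_pos (φ n)).le
    simp only [Function.comp_apply]
    linarith
  let u : cameronMartin μ := ⟨covSqrt μ z, z, rfl⟩
  have hu : cameronMartinNorm μ u ^ 2 ≤ ‖z‖ ^ 2 :=
    pow_le_pow_left₀ (norm_nonneg _) (cameronMartinNorm_le μ rfl) 2
  refine ⟨u, ?_, φ, hφ, hv⟩
  have hΦu : Φ u ≤ a - ‖z‖ ^ 2 / 2 := le_of_forall_lt_imp_le_of_dense fun p hp => by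
    linarith [hle_a p hp]
  rw [cameronMartinEnergy]
  linarith

lemma eventually_forall_expWeighted_ball_le (hμ : ∫ x, x ∂μ = 0) (hΦ : Continuous Φ)
    (hbdd : BddBelow (Set.range Φ)) (ha : ∀ u, a < cameronMartinEnergy μ Φ u) :
    ∀ᶠ r in 𝓝[>] (0 : ℝ), ∀ v, expWeighted μ Φ (Metric.ball v r)
      ≤ ENNReal.ofReal (Real.exp (-a)) * μ (Metric.ball 0 r) := by
  by_contra h
  obtain ⟨r, hr, hrv⟩ := exists_seq_forall_of_frequently
    ((not_eventually.1 h).and_eventually self_mem_nhdsWithin)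
  push Not at hrv
  choose v hv using fun n => (hrv n).1
  obtain ⟨u, hu, -⟩ := exists_subseq_tendsto_of_le_expWeighted_ball hμ hΦ hbdd
    (fun n => (hrv n).2) (tendsto_nhds_of_tendsto_nhdsWithin hr) fun n => (hv n).le
  exact (ha u).not_ge hu

lemma exists_cameronMartinEnergy_le_of_frequently (hμ : ∫ x, x ∂μ = 0) (hΦ : Continuous Φ)
    (hbdd : BddBelow (Set.range Φ)) {u : X}
    (h : ∃ᶠ r in 𝓝[>] (0 : ℝ), ENNReal.ofReal (Real.exp (-a)) * μ (Metric.ball 0 r)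
      ≤ expWeighted μ Φ (Metric.ball u r)) :
    ∃ hu : u ∈ cameronMartin μ, cameronMartinEnergy μ Φ ⟨u, hu⟩ ≤ a := by
  obtain ⟨r, hr, hru⟩ := exists_seq_forall_of_frequently (h.and_eventually self_mem_nhdsWithin)
  obtain ⟨u', hu', φ, -, hlim⟩ := exists_subseq_tendsto_of_le_expWeighted_ball hμ hΦ hbdd
    (fun n => (hru n).2) (tendsto_nhds_of_tendsto_nhdsWithin hr) fun n => (hru n).1
  obtain rfl : u = u' := tendsto_nhds_unique tendsto_const_nhds hlim
  exact ⟨u'.2, hu'⟩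

end SmallBalls

section Mode

lemma isMode_smul_iff {X : Type*} [NormedAddCommGroup X] [InnerProductSpace ℝ X]
    [MeasurableSpace X] (ν : Measure X) {c : ℝ≥0∞} (hc : c ≠ 0) (hc' : c ≠ ∞) (u : X) :
    IsMode (c • ν) u ↔ IsMode ν u := by
  simp only [IsMode, Measure.smul_apply, smul_eq_mul, ← ENNReal.mul_iSup,
    ENNReal.mul_div_mul_left _ _ hc hc']

variable {X : Type*} [NormedAddCommGroup X] [InnerProductSpace ℝ X] [CompleteSpace X]
  [SecondCountableTopology X] [MeasurableSpace X] [BorelSpace X] {μ : Measure X} [IsGaussian μ]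
  {Φ : X → ℝ}

lemma isMode_expWeighted_of_isMinOn (hμ : ∫ x, x ∂μ = 0) (hΦ : Continuous Φ)
    (hbdd : BddBelow (Set.range Φ)) {u : cameronMartin μ}
    (hu : IsMinOn (cameronMartinEnergy μ Φ) Set.univ u) : IsMode (expWeighted μ Φ) (u : X) := by
  set m := cameronMartinEnergy μ Φ u
  refine tendsto_order.2 ⟨fun l hl => ?_, fun l hl => Eventually.of_forall fun r =>
    (ENNReal.div_le_of_le_mul ?_).trans_lt hl⟩
  · have hcont : Tendsto (fun ε : ℝ => ENNReal.ofReal (Real.exp (-(m + ε) - -(m - ε))))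
        (𝓝[>] 0) (𝓝 1) := by
      have h : Continuous fun ε : ℝ => ENNReal.ofReal (Real.exp (-(m + ε) - -(m - ε))) :=
        ENNReal.continuous_ofReal.comp (by fun_prop)
      simpa using tendsto_nhdsWithin_of_tendsto_nhds (h.tendsto 0)
    obtain ⟨ε, hlε, hε : 0 < ε⟩ :=
      ((hcont.eventually_const_lt hl).and self_mem_nhdsWithin).exists
    filter_upwards [self_mem_nhdsWithin,
      eventually_forall_expWeighted_ball_le hμ hΦ hbdd (a := m - ε)
        fun v => (sub_lt_self m hε).trans_le (isMinOn_univ_iff.1 hu v),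
      eventually_le_expWeighted_ball hμ hΦ (lt_add_of_pos_right m hε)] with r hr hupper hlower
    refine (hlε.trans_eq ?_).trans_le (ENNReal.div_le_div hlower (iSup_le hupper))
    rw [ENNReal.mul_div_mul_right _ _ (measure_ball_zero_pos hμ hr).ne' (measure_ne_top _ _),
      ← ENNReal.ofReal_div_of_pos (Real.exp_pos _), Real.exp_sub]
  · rw [one_mul]
    exact le_iSup (fun v => expWeighted μ Φ (Metric.ball v r)) (u : X)

lemma exists_cameronMartinEnergy_le_of_isMode (hμ : ∫ x, x ∂μ = 0) (hΦ : Continuous Φ)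
    (hbdd : BddBelow (Set.range Φ)) {u : X} (hmode : IsMode (expWeighted μ Φ) u)
    {v : cameronMartin μ} {c : ℝ} (hc : cameronMartinEnergy μ Φ v < c) :
    ∃ hu : u ∈ cameronMartin μ, cameronMartinEnergy μ Φ ⟨u, hu⟩ ≤ c := by
  obtain ⟨a, hva, hac⟩ := exists_between hc
  have hexp : ENNReal.ofReal (Real.exp (-(c - a))) < 1 := by
    rw [ENNReal.ofReal_lt_one, Real.exp_lt_one_iff]
    linarith
  refine exists_cameronMartinEnergy_le_of_frequently hμ hΦ hbdd (Eventually.frequently ?_)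
  filter_upwards [hmode.eventually_const_lt hexp, eventually_le_expWeighted_ball hμ hΦ hva]
    with r hratio hlower
  calc ENNReal.ofReal (Real.exp (-c)) * μ (Metric.ball 0 r)
      = ENNReal.ofReal (Real.exp (-(c - a)))
          * (ENNReal.ofReal (Real.exp (-a)) * μ (Metric.ball 0 r)) := by
        rw [← mul_assoc, ← ENNReal.ofReal_mul (Real.exp_nonneg _), ← Real.exp_add]
        ring_nf
    _ ≤ ENNReal.ofReal (Real.exp (-(c - a))) * ⨆ v, expWeighted μ Φ (Metric.ball v r) :=
        mul_le_mul_right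
          (hlower.trans (le_iSup (fun v => expWeighted μ Φ (Metric.ball v r)) (v : X))) _
    _ ≤ expWeighted μ Φ (Metric.ball u r) := ENNReal.mul_le_of_le_div hratio.le

theorem isMode_expWeighted_iff (hμ : ∫ x, x ∂μ = 0) (hΦ : Continuous Φ)
    (hbdd : BddBelow (Set.range Φ)) {u : X} :
    IsMode (expWeighted μ Φ) u ↔
      ∃ hu : u ∈ cameronMartin μ, IsMinOn (cameronMartinEnergy μ Φ) Set.univ ⟨u, hu⟩ := by
  refine ⟨fun hmode => ?_, fun ⟨hu, hmin⟩ =>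
    isMode_expWeighted_of_isMinOn hμ hΦ hbdd (u := ⟨u, hu⟩) hmin⟩
  have hle (v : cameronMartin μ) {c : ℝ} (hc : cameronMartinEnergy μ Φ v < c) :=
    exists_cameronMartinEnergy_le_of_isMode hμ hΦ hbdd hmode hc
  obtain ⟨hu, -⟩ := hle 0 (lt_add_one _)
  exact ⟨hu, isMinOn_univ_iff.2 fun v => le_of_forall_gt_imp_ge_of_dense fun c hc =>
    (hle v hc).2⟩

lemma tilted_neg_eq_smul_expWeighted {X : Type*} [MeasurableSpace X] (μ : Measure X) {Φ : X → ℝ}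
    (hΦ : Measurable Φ) : μ.tilted (fun x => -Φ x)
      = ENNReal.ofReal (∫ x, Real.exp (-Φ x) ∂μ)⁻¹ • expWeighted μ Φ := by
  rw [expWeighted, ← withDensity_smul _ (by fun_prop), Measure.tilted]
  congr 1
  ext x
  rw [Pi.smul_apply, smul_eq_mul, ← ENNReal.ofReal_mul (by positivity), div_eq_inv_mul]

lemma integral_exp_neg_pos {X : Type*} [MeasurableSpace X] {μ : Measure X}
    [IsFiniteMeasure μ] [NeZero μ] {Φ : X → ℝ} (hΦ : Measurable Φ)
    (hbdd : BddBelow (Set.range Φ)) : 0 < ∫ x, Real.exp (-Φ x) ∂μ := by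
  obtain ⟨q, hq⟩ := hbdd
  refine integral_exp_pos (Integrable.of_bound (C := Real.exp (-q)) (by fun_prop)
    (ae_of_all _ fun x => ?_))
  rw [Real.norm_eq_abs, Real.abs_exp]
  gcongr
  exact hq ⟨x, rfl⟩

end Mode

section BayesianPosterior

variable {X : Type*} [NormedAddCommGroup X] [InnerProductSpace ℝ X] {N M : ℕ}
  {φ : Fin N → StrongDual ℝ X} {F : EuclideanSpace ℝ (Fin N) → EuclideanSpace ℝ (Fin M)}
  {y : EuclideanSpace ℝ (Fin M)} {β : ℝ}

variable (φ F y β) in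
/-- The data misfit `|F (φ u) - y|² / (2 β²)`, the potential of the posterior. -/
noncomputable def misfit (u : X) : ℝ :=
  1 / (2 * β ^ 2) * ‖obsMap φ F u - y‖ ^ 2

lemma misfit_nonneg (u : X) : 0 ≤ misfit φ F y β u := by
  rw [misfit]
  positivity

lemma IsLocallyLipschitz.continuous (hF : IsLocallyLipschitz F) : Continuous F := by
  refine continuous_iff_continuousAt.2 fun z => ?_
  obtain ⟨L, hL, h⟩ := hF (‖z‖ + 1) (by positivity)
  have hlip : LipschitzOnWith L.toNNReal F (Metric.ball 0 (‖z‖ + 1)) :=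
    LipschitzOnWith.of_dist_le_mul fun x hx y hy => by
      rw [dist_eq_norm, dist_eq_norm, Real.coe_toNNReal L hL.le]
      exact h x hx y hy
  exact hlip.continuousOn.continuousAt (Metric.isOpen_ball.mem_nhds (by simp))

lemma continuous_misfit (hF : Continuous F) : Continuous (misfit φ F y β) := by
  unfold misfit obsMap
  fun_prop

lemma posterior_eq_tilted [MeasurableSpace X] (μ : Measure X) :
    posterior μ φ F y β = μ.tilted (fun u => -misfit φ F y β u) := by
  simp only [posterior, Measure.tilted, misfit, neg_mul]

variable [CompleteSpace X] [MeasurableSpace X] [BorelSpace X] {μ : Measure X} {u : X}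

lemma onsagerMachlup_coe (u : cameronMartin μ) :
    onsagerMachlup μ φ F y β u
      = ENNReal.ofReal (cameronMartinEnergy μ (misfit φ F y β) u) := by
  rw [onsagerMachlup, dif_pos u.2, cameronMartinEnergy, misfit, one_div_mul_eq_div (2 : ℝ)]

lemma onsagerMachlup_eq_top (hu : u ∉ cameronMartin μ) : onsagerMachlup μ φ F y β u = ⊤ :=
  dif_neg hu

lemma isMinOn_onsagerMachlup_iff :
    IsMinOn (onsagerMachlup μ φ F y β) Set.univ u ↔ ∃ hu : u ∈ cameronMartin μ,
      IsMinOn (cameronMartinEnergy μ (misfit φ F y β)) Set.univ ⟨u, hu⟩ := by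
  have hle_iff (w v : cameronMartin μ) : onsagerMachlup μ φ F y β w ≤ onsagerMachlup μ φ F y β v ↔
      cameronMartinEnergy μ (misfit φ F y β) w ≤ cameronMartinEnergy μ (misfit φ F y β) v := by
    rw [onsagerMachlup_coe, onsagerMachlup_coe, ENNReal.ofReal_le_ofReal_iff]
    exact add_nonneg (misfit_nonneg _) (by positivity)
  simp only [isMinOn_univ_iff]
  constructor
  · intro hmin
    have hu : u ∈ cameronMartin μ := by
      by_contra hu
      have h0 := hmin (0 : cameronMartin μ)
      rw [onsagerMachlup_eq_top hu, onsagerMachlup_coe] at h0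
      exact ENNReal.ofReal_ne_top (top_le_iff.1 h0)
    exact ⟨hu, fun v => (hle_iff ⟨u, hu⟩ v).1 (hmin v)⟩
  · rintro ⟨hu, hmin⟩ v
    by_cases hv : v ∈ cameronMartin μ
    · exact (hle_iff ⟨u, hu⟩ ⟨v, hv⟩).2 (hmin ⟨v, hv⟩)
    · exact le_top.trans_eq (onsagerMachlup_eq_top hv).symm

end BayesianPosterior

end GaussianMAP

open GaussianMAP in
theorem mainTheorem6_general {X : Type*} [NormedAddCommGroup X] [InnerProductSpace ℝ X]
    [CompleteSpace X] [SecondCountableTopology X] [MeasurableSpace X] [BorelSpace X]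
    {μ : Measure X} [IsGaussian μ] (hμ : ∫ x, x ∂μ = 0) {Φ : X → ℝ} (hΦ : Continuous Φ)
    (hbdd : BddBelow (Set.range Φ)) {u : X} :
    IsMode (μ.tilted fun x => -Φ x) u ↔
      ∃ hu : u ∈ cameronMartin μ, IsMinOn (cameronMartinEnergy μ Φ) Set.univ ⟨u, hu⟩ := by
  rw [tilted_neg_eq_smul_expWeighted μ hΦ.measurable, isMode_smul_iff _ _ ENNReal.ofReal_ne_top,
    isMode_expWeighted_iff hμ hΦ hbdd]
  simpa using integral_exp_neg_pos (μ := μ) hΦ.measurable hbdd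

/-- `X` is a separable real Hilbert space and `μ = N(0, K)` a centered Gaussian measure on it. -/
theorem mainTheorem6 {X : Type*} [NormedAddCommGroup X] [InnerProductSpace ℝ X] [CompleteSpace X]
    [TopologicalSpace.SeparableSpace X] [MeasurableSpace X] [BorelSpace X]
    (μ : Measure X) [IsGaussian μ] (hμ : ∫ x, x ∂μ = 0)
    {N M : ℕ} (φ : Fin N → StrongDual ℝ X)
    (F : EuclideanSpace ℝ (Fin N) → EuclideanSpace ℝ (Fin M))
    (hF : GaussianMAP.IsLocallyLipschitz F)
    (y : EuclideanSpace ℝ (Fin M)) (β : ℝ) (hβ : 0 < β) (u : X) :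
    GaussianMAP.IsMode (GaussianMAP.posterior μ φ F y β) u ↔
      IsMinOn (GaussianMAP.onsagerMachlup μ φ F y β) Set.univ u := by
  have : SecondCountableTopology X := UniformSpace.secondCountable_of_separable X
  rw [GaussianMAP.posterior_eq_tilted, GaussianMAP.isMinOn_onsagerMachlup_iff]
  exact mainTheorem6_general hμ (GaussianMAP.continuous_misfit hF.continuous)
    ⟨0, Set.forall_mem_range.2 GaussianMAP.misfit_nonneg⟩
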